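/- **Setting.** Let $\mathcal S^d$ be the space of real symmetric $d\times d$ matrices with the inner product $\langle U,W\rangle=\sum_{i,j}U_{ij}W_{ij}$ and the Frobenius norm $\|\cdot\|_F$, let $\mathcal S^d_+$ be the cone of positive semidefinite matrices, and let $\|U\|_{(r)}$ be the sum of the $r$ largest singular values of $U$. Let $n\ge 1$, $1\le r\le d$, $c>0$, $\alpha>0$, $\kappa\in(0,1)$, $b\in\mathbb R^p$, and let $\mathcal A:\mathcal S^d\to\mathbb R^p$ be linear and satisfy the $r$-restricted isometry property: the smallest $R_r$ such that $(1-R_r)\|U\|_F^2\le\|\mathcal A(U)\|^2\le(1+R_r)\|U\|_F^2$ for all $U\in\mathcal S^d_+$ of rank at most $r$ satisfies $0\le R_r<1$. Put $$f_1(U)=\tfrac1n\|\mathcal A(U)-b\|^2+c\langle U,I\rangle,\qquad f_2(U)=c\|U\|_{(r)},\qquad J_c=f_1-f_2,$$ and consider the problem $\min_{U\in\mathcal S^d_+}J_c(U)$. Let $f_2^*(W)=\sup_{U\in\mathcal S^d_+}\{\langle W,U\rangle-f_2(U)\}$, and let $\partial f_2$ be the convex subdifferential of $f_2$ on $\mathcal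 S^d$. **Algorithm** (s-iPDCA with stopping tolerance $0$). Let $(\epsilon_{k+1})_{k\ge0}$ be nonnegative and nonincreasing with limit $0$. Start from $U^0=V^0\in\mathcal S^d_+$ and $W^0\in\partial f_2(U^0)$. In iteration $k\ge 0$ compute $V^{k+1}$ and $\Delta^{k+1}\in\mathcal S^d$ with $\|\Delta^{k+1}\|_F\le\epsilon_{k+1}$ such that $V^{k+1}$ minimizes $$f_1(U)-\langle U,W^k\rangle+\tfrac\alpha2\|U-U^k\|_F^2-\langle\Delta^{k+1},U\rangle$$ over $U\in\mathcal S^d_+$. If $V^{k+1}=U^k$, stop. If $\|\Delta^{k+1}\|_F<\frac{(1-\kappa)\alpha}2\|V^{k+1}-U^k\|_F$ (a serious step), set $U^{k+1}=V^{k+1}$ and choose any $W^{k+1}\in\partial f_2(U^{k+1})$; otherwise (a null step) set $U^{k+1}=U^k$ and $W^{k+1}=W^k$. Suppose that infinitely many serious steps are performed. Let $k_0=0$ and, for $l\ge1$, let $U^{k_l}$ be the iterate produced by the $l$-th serious step. Define $E:(\mathcal S^d)^4\to(-\infty,\infty]$ by $$E(U,W,V,T)=f_1(U)-\langle U,W\rangle+f_2^*(W)+\tfrac\alpha2\|U-V\|_F^2-\langle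 T,U-V\rangle\quad\text{if }U\in\mathcal S^d_+,$$ and $E(U,W,V,T)=\infty$ if $U\notin\mathcal S^d_+$. Let $z_l=(U^{k_{l+1}},W^{k_l},U^{k_l},\Delta^{k_{l+1}})$ for $l\ge0$. **Proposition.** $E(z_l)$ is finite for every $l\ge0$, and the following hold. 1. $J_c(U^{k_{l+1}})\le E(z_l)$ for all $l\ge0$. 2. $E(z_l)-E(z_{l-1})\le-\frac{\kappa\alpha}2\|U^{k_l}-U^{k_{l-1}}\|_F^2$ for all $l\ge1$. 3. The set $\Gamma$ of accumulation points of $(z_l)$ is nonempty and compact. 4. The limit $\Upsilon=\lim_{l\to\infty}E(z_l)$ exists in $\mathbb R$, and $E\equiv\Upsilon$ on $\Gamma$. 5. There is $\rho>0$ such that $\operatorname{dist}(0,\partial E(z_l))\le\rho\|U^{k_{l+1}}-U^{k_l}\|_F$ for all $l\ge0$, where $\partial E$ is the limiting subdifferential (in particular $\partial E(z_l)\ne\emptyset$). -/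

import Mathlib

open Filter Topology
open scoped RealInnerProductSpace

noncomputable section

/-- The linear subspace of symmetric matrices inside the real `d × d` matrices. -/
def symSubmodule (d : ℕ) : Submodule ℝ (Matrix (Fin d) (Fin d) ℝ) where
  carrier := {M | M.IsSymm}
  add_mem' := fun ha hb => Matrix.IsSymm.add ha hb
  zero_mem' := Matrix.isSymm_zero
  smul_mem' := fun c _ h => Matrix.IsSymm.smul h c

/-- The space `S^d` of real symmetric `d × d` matrices; below it gets the inner product
`⟪U, W⟫ = ∑ i j, U i j * W i j`, so that its norm is the Frobenius norm. -/
def SymMat (d : ℕ) : Type := symSubmodule d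

namespace SymMat

variable {d : ℕ}

instance : AddCommGroup (SymMat d) := inferInstanceAs (AddCommGroup (symSubmodule d))
instance : Module ℝ (SymMat d) := inferInstanceAs (Module ℝ (symSubmodule d))
instance : FiniteDimensional ℝ (SymMat d) :=
  inferInstanceAs (FiniteDimensional ℝ (symSubmodule d))

/-- The underlying matrix, as a linear map. -/
def toMat : SymMat d →ₗ[ℝ] Matrix (Fin d) (Fin d) ℝ := (symSubmodule d).subtype

theorem toMat_injective : Function.Injective (toMat (d := d)) := Subtype.val_injective

/-- The identity matrix as an element of `S^d`. -/
def ident (d : ℕ) : SymMat d := ⟨1, Matrix.isSymm_one⟩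

theorem toMat_ident : toMat (ident d) = 1 := rfl

/-- The Frobenius inner product. -/
@[reducible] def innerCore (d : ℕ) : InnerProductSpace.Core ℝ (SymMat d) where
  inner U W := ∑ i, ∑ j, toMat U i j * toMat W i j
  conj_inner_symm U W := by
    simp only [conj_trivial]
    exact Finset.sum_congr rfl fun i _ => Finset.sum_congr rfl fun j _ => mul_comm _ _
  re_inner_nonneg U := by
    simp only [RCLike.re_to_real]
    exact Finset.sum_nonneg fun i _ => Finset.sum_nonneg fun j _ => mul_self_nonneg _
  add_left U V W := by
    simp [add_mul, Finset.sum_add_distrib]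
  smul_left U W t := by
    simp [Finset.mul_sum, mul_assoc]
  definite U h := by
    apply toMat_injective
    ext i j
    have h1 := (Finset.sum_eq_zero_iff_of_nonneg (fun i _ =>
      Finset.sum_nonneg fun j _ => mul_self_nonneg (toMat U i j))).1 h i (Finset.mem_univ i)
    have h2 := (Finset.sum_eq_zero_iff_of_nonneg (fun j _ =>
      mul_self_nonneg (toMat U i j))).1 h1 j (Finset.mem_univ j)
    simpa using h2

instance : NormedAddCommGroup (SymMat d) := (innerCore d).toNormedAddCommGroup
instance : InnerProductSpace ℝ (SymMat d) := InnerProductSpace.ofCore (innerCore d).toCore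

theorem inner_eq (U W : SymMat d) : ⟪U, W⟫ = ∑ i, ∑ j, toMat U i j * toMat W i j := rfl

end SymMat

/-- The cone `S^d_+` of positive semidefinite matrices. -/
def psdCone (d : ℕ) : Set (SymMat d) := {U | (SymMat.toMat U).PosSemidef}

/-- The Ky Fan `r`-norm: the sum of the `r` largest singular values
(Mathlib lists the singular values in nonincreasing order, starting from index `0`). -/
def kyFan {d : ℕ} (r : ℕ) (U : SymMat d) : ℝ :=
  ∑ i ∈ Finset.range r, (Matrix.toEuclideanLin (SymMat.toMat U)).singularValues i

/-- The restricted isometry inequalities with constant `R`, on the elements of `S^d_+` of rank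
at most `r`. -/
def RIPBound {d p : ℕ} (A : SymMat d →ₗ[ℝ] EuclideanSpace ℝ (Fin p)) (r : ℕ) (R : ℝ) : Prop :=
  ∀ U ∈ psdCone d, (SymMat.toMat U).rank ≤ r →
    (1 - R) * ‖U‖ ^ 2 ≤ ‖A U‖ ^ 2 ∧ ‖A U‖ ^ 2 ≤ (1 + R) * ‖U‖ ^ 2

/-- The `r`-restricted isometry property: the smallest constant `R` in the restricted isometry
inequalities satisfies `0 ≤ R < 1`. -/
def SatisfiesRIP {d p : ℕ} (A : SymMat d →ₗ[ℝ] EuclideanSpace ℝ (Fin p)) (r : ℕ) : Prop :=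
  ∃ R : ℝ, IsLeast {R' | RIPBound A r R'} R ∧ 0 ≤ R ∧ R < 1

/-- `f₁(U) = (1/n) ‖A U - b‖² + c ⟪U, I⟫`. -/
def f1 {d p : ℕ} (n : ℕ) (A : SymMat d →ₗ[ℝ] EuclideanSpace ℝ (Fin p))
    (b : EuclideanSpace ℝ (Fin p)) (c : ℝ) (U : SymMat d) : ℝ :=
  1 / (n : ℝ) * ‖A U - b‖ ^ 2 + c * ⟪U, SymMat.ident d⟫

/-- `f₂(U) = c ‖U‖_(r)`. -/
def f2 {d : ℕ} (r : ℕ) (c : ℝ) (U : SymMat d) : ℝ := c * kyFan r U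

/-- The objective `J_c = f₁ - f₂` of the problem of minimizing `J_c` over `S^d_+`. -/
def Jc {d p : ℕ} (n : ℕ) (A : SymMat d →ₗ[ℝ] EuclideanSpace ℝ (Fin p))
    (b : EuclideanSpace ℝ (Fin p)) (r : ℕ) (c : ℝ) (U : SymMat d) : ℝ :=
  f1 n A b c U - f2 r c U

/-- The subdifferential of a (convex) real-valued function on an inner product space. -/
def convexSubdiff {H : Type*} [NormedAddCommGroup H] [InnerProductSpace ℝ H]
    (f : H → ℝ) (x : H) : Set H :=
  {v | ∀ y, f x + ⟪v, y - x⟫ ≤ f y}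

/-- The conjugate `f₂*(W) = sup {⟪W, U⟫ - f₂(U) | U ∈ S^d_+}`, with values in `[-∞, ∞]`. -/
def f2conj {d : ℕ} (r : ℕ) (c : ℝ) (W : SymMat d) : EReal :=
  ⨆ U ∈ psdCone d, ((⟪W, U⟫ - f2 r c U : ℝ) : EReal)

/-- The space of quadruples `(U, W, V, T)` of symmetric matrices with the Euclidean norm. -/
abbrev Quad (d : ℕ) : Type := PiLp 2 (fun _ : Fin 4 => SymMat d)

/-- The quadruple `(U, W, V, T)`. -/
def quad {d : ℕ} (U W V T : SymMat d) : Quad d := WithLp.toLp 2 ![U, W, V, T]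

open Classical in
/-- The auxiliary function
`E(U, W, V, T) = f₁(U) - ⟪U, W⟫ + f₂*(W) + (α/2) ‖U - V‖² - ⟪T, U - V⟫`,
an extended-real-valued function in which `f₁` has the domain `S^d_+`, that is,
`E = ∞` for `U` outside `S^d_+`. -/
def auxE {d p : ℕ} (n : ℕ) (A : SymMat d →ₗ[ℝ] EuclideanSpace ℝ (Fin p))
    (b : EuclideanSpace ℝ (Fin p)) (r : ℕ) (c α : ℝ) (z : Quad d) : EReal :=
  if z 0 ∈ psdCone d then
    ((f1 n A b c (z 0) - ⟪z 0, z 1⟫ + α / 2 * ‖z 0 - z 2‖ ^ 2 - ⟪z 3, z 0 - z 2⟫ : ℝ) : EReal)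
      + f2conj r c (z 1)
  else ⊤

/-- The regular (Fréchet) subdifferential of an extended-real-valued function:
`v` with `f y ≥ f x + ⟪v, y - x⟫ + o(‖y - x‖)`; it is empty where `f` is not finite. -/
def regularSubdiff {H : Type*} [NormedAddCommGroup H] [InnerProductSpace ℝ H]
    (f : H → EReal) (x : H) : Set H :=
  {v | f x ≠ ⊤ ∧ f x ≠ ⊥ ∧ ∀ ε : ℝ, 0 < ε →
    ∀ᶠ y in 𝓝 x, f x + ((⟪v, y - x⟫ - ε * ‖y - x‖ : ℝ) : EReal) ≤ f y}

/-- The (limiting) subdifferential of an extended-real-valued function: the limits of regular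
subgradients `vs m` at points `xs m → x` with `f (xs m) → f x`. -/
def limitingSubdiff {H : Type*} [NormedAddCommGroup H] [InnerProductSpace ℝ H]
    (f : H → EReal) (x : H) : Set H :=
  {v | f x ≠ ⊤ ∧ f x ≠ ⊥ ∧ ∃ xs vs : ℕ → H,
    Tendsto xs atTop (𝓝 x) ∧ Tendsto (fun m => f (xs m)) atTop (𝓝 (f x)) ∧
    (∀ m, vs m ∈ regularSubdiff f (xs m)) ∧ Tendsto vs atTop (𝓝 v)}

/-- The objective of the perturbed proximal subproblem with linearization `W`, proximal center
`U₀` and inexactness term `D`. -/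
def subObj {d p : ℕ} (n : ℕ) (A : SymMat d →ₗ[ℝ] EuclideanSpace ℝ (Fin p))
    (b : EuclideanSpace ℝ (Fin p)) (c α : ℝ) (W U₀ D U : SymMat d) : ℝ :=
  f1 n A b c U - ⟪U, W⟫ + α / 2 * ‖U - U₀‖ ^ 2 - ⟪D, U⟫

/-- The test for a serious step in iteration `k`. -/
def IsSerious {d : ℕ} (α κ : ℝ) (U V Δ : ℕ → SymMat d) (k : ℕ) : Prop :=
  ‖Δ (k + 1)‖ < (1 - κ) * α / 2 * ‖V (k + 1) - U k‖

/-- `(U, V, W, Δ)` is a nonterminating run of the inexact proximal DC algorithm with sieving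
strategy, with stopping tolerance `tol`; `U` are the stability centers, `V` the trial points,
`W` the chosen subgradients, `Δ (k + 1)` the inexactness terms (the entry `Δ 0` is not used)
and `eps k` is the error bound `ε_{k+1}` of iteration `k`. -/
structure IsRun {d p : ℕ} (n : ℕ) (A : SymMat d →ₗ[ℝ] EuclideanSpace ℝ (Fin p))
    (b : EuclideanSpace ℝ (Fin p)) (r : ℕ) (c α κ tol : ℝ) (eps : ℕ → ℝ)
    (U V W Δ : ℕ → SymMat d) : Prop where
  eps_nonneg : ∀ k, 0 ≤ eps k
  eps_antitone : Antitone eps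
  eps_tendsto : Tendsto eps atTop (𝓝 0)
  init_eq : U 0 = V 0
  init_mem : U 0 ∈ psdCone d
  init_subgrad : W 0 ∈ convexSubdiff (f2 r c) (U 0)
  inexact : ∀ k, ‖Δ (k + 1)‖ ≤ eps k
  trial_mem : ∀ k, V (k + 1) ∈ psdCone d
  trial_min : ∀ k, IsMinOn (subObj n A b c α (W k) (U k) (Δ (k + 1))) (psdCone d) (V (k + 1))
  no_stop : ∀ k, tol < ‖V (k + 1) - U k‖
  serious_center : ∀ k, IsSerious α κ U V Δ k → U (k + 1) = V (k + 1)
  serious_subgrad : ∀ k, IsSerious α κ U V Δ k → W (k + 1) ∈ convexSubdiff (f2 r c) (U (k + 1))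
  null_center : ∀ k, ¬ IsSerious α κ U V Δ k → U (k + 1) = U k
  null_subgrad : ∀ k, ¬ IsSerious α κ U V Δ k → W (k + 1) = W k

/-- The index `k_l` of the stability center produced by the `l`-th serious step, for `l ≥ 1`;
`k_0 = 0` is the index of the starting point. -/
def seriousIdx {d : ℕ} (α κ : ℝ) (U V Δ : ℕ → SymMat d) : ℕ → ℕ
  | 0 => 0
  | l + 1 => Nat.nth (IsSerious α κ U V Δ) l + 1

/-- The quadruple `(U^{k_{l+1}}, W^{k_l}, U^{k_l}, Δ^{k_{l+1}})`. -/
def seriousQuad {d : ℕ} (α κ : ℝ) (U V W Δ : ℕ → SymMat d) (l : ℕ) : Quad d :=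
  quad (U (seriousIdx α κ U V Δ (l + 1))) (W (seriousIdx α κ U V Δ l))
    (U (seriousIdx α κ U V Δ l)) (Δ (seriousIdx α κ U V Δ (l + 1)))

/-- The set of accumulation points of a sequence. -/
def accPts {X : Type*} [TopologicalSpace X] (x : ℕ → X) : Set X :=
  {y | MapClusterPt y atTop x}

end

/-! Since `f2` is positively homogeneous, a subgradient `W` at `U` satisfies `⟪W, U⟫ = f2 U` and
`⟪W, ·⟫ ≤ f2` (`inner_le_f2_of_mem_convexSubdiff`). Hence its conjugate vanishes (`f2conj_eq_zero`),
and along the run `E` is the continuous real function `auxReal`. Null steps change neither center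
nor subgradient, so consecutive serious iterates `u l`, `u (l+1)` are linked by one subproblem. The
serious-step test and minimality against the old center give the sandwich `J(u (l+1)) + κα/2 ‖u
(l+1) - u l‖² ≤ E(z_l) ≤ J(u l)` (`descent`, `auxReal_le`). This yields (1) and (2), and, with
`Jc_nonneg`, convergence of `E(z_l)`. For (3), split `U = X + (U - X)` with `X` of rank at most `r`
and remainder at most trace minus Ky Fan norm. The penalty bounds the remainder and restricted
isometry bounds `X`, so level sets of `J` are bounded. For (4), positive semidefiniteness and
domination by `f2` pass to limits, so `E` is still `auxReal` at accumulation points. For (5),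
subproblem optimality makes `(0, V - U, T - α(U - V), V - U)` a regular subgradient of `E` at `(U,
W, V, T)`, of norm at most a multiple of `‖U - V‖`. -/

noncomputable section

/-! ### Eigenvalues and singular values. -/

theorem LinearMap.IsSymmetric.eigenvalues_eq_of_orthonormalBasis {E : Type*} [NormedAddCommGroup E]
    [InnerProductSpace ℝ E] [FiniteDimensional ℝ E] {n : ℕ} {S : E →ₗ[ℝ] E} (hS : S.IsSymmetric)
    (hn : Module.finrank ℝ E = n) (b : OrthonormalBasis (Fin n) ℝ E) (μ : Fin n → ℝ)
    (hμ : Antitone μ) (hb : ∀ i, S (b i) = μ i • b i) : hS.eigenvalues hn = μ := by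
  have hmat : S.toMatrix b.toBasis b.toBasis = Matrix.diagonal μ := by
    ext i j
    rw [LinearMap.toMatrix_apply, b.coe_toBasis, hb, map_smul, Finsupp.smul_apply,
      ← b.coe_toBasis, Module.Basis.repr_self, Matrix.diagonal_apply, Finsupp.single_apply]
    by_cases h : i = j
    · subst h; simp
    · simp [h, Ne.symm h]
  have hcp : S.charpoly = ∏ i, (Polynomial.X - Polynomial.C (μ i)) := by
    rw [← LinearMap.charpoly_toMatrix S b.toBasis, hmat, Matrix.charpoly_diagonal]
  have hroots : S.charpoly.roots = Multiset.map μ Finset.univ.val := by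
    rw [hcp, Polynomial.roots_prod _ _ (Finset.prod_ne_zero_iff.2 fun i _ =>
      Polynomial.X_sub_C_ne_zero (μ i))]
    simp [Multiset.bind_singleton]
  -- Both sides list the same multiset of roots of the characteristic polynomial in nonincreasing
  -- order.
  rw [← List.ofFn_inj, ← hS.sort_roots_charpoly_eq_eigenvalues hn, hroots, Fin.univ_val_map,
    Multiset.map_coe, Multiset.coe_sort]
  simp only [List.map_ofFn, Function.comp_def, RCLike.re_to_real]
  refine List.mergeSort_of_pairwise ?_
  simp_rw [decide_eq_true_eq, ← List.sortedGE_iff_pairwise]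
  exact hμ.sortedGE_ofFn

/-- An eigenbasis of `T* T` also diagonalizes `(tT)* (tT)`, with eigenvalues multiplied by `t²`.
This supplies the homogeneity of the Ky Fan norm. -/
theorem LinearMap.singularValues_smul {E F : Type*} [NormedAddCommGroup E]
    [InnerProductSpace ℝ E] [FiniteDimensional ℝ E] [NormedAddCommGroup F]
    [InnerProductSpace ℝ F] [FiniteDimensional ℝ F] (T : E →ₗ[ℝ] F) {t : ℝ} (ht : 0 ≤ t) (i : ℕ) :
    (t • T).singularValues i = t * T.singularValues i := by
  by_cases hi : i < Module.finrank ℝ E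
  · have hS := T.isSymmetric_adjoint_comp_self
    have key := (t • T).isSymmetric_adjoint_comp_self.eigenvalues_eq_of_orthonormalBasis rfl
      (hS.eigenvectorBasis rfl) (fun j => t ^ 2 * hS.eigenvalues rfl j)
      (fun j k hjk => mul_le_mul_of_nonneg_left (hS.eigenvalues_antitone rfl hjk) (sq_nonneg t))
      (fun j => by
        have h := hS.apply_eigenvectorBasis rfl j
        simp only [LinearMap.comp_apply] at h
        simp only [LinearMap.comp_apply, map_smul, LinearMap.smul_apply]
        rw [h, smul_smul, smul_smul]
        simp [pow_two, mul_assoc])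
    rw [singularValues_of_lt _ rfl hi, singularValues_of_lt _ rfl hi, key,
      Real.sqrt_mul (sq_nonneg t), Real.sqrt_sq ht]
  · push Not at hi
    simp [singularValues_of_finrank_le _ hi]

/-- A positive operator is diagonalized by a basis of singular vectors. -/
theorem LinearMap.IsPositive.exists_orthonormalBasis_singularValues {E : Type*}
    [NormedAddCommGroup E] [InnerProductSpace ℝ E] [FiniteDimensional ℝ E] {n : ℕ} {T : E →ₗ[ℝ] E}
    (hT : T.IsPositive) (hn : Module.finrank ℝ E = n) :
    ∃ b : OrthonormalBasis (Fin n) ℝ E, ∀ i : Fin n, T (b i) = T.singularValues i • b i := by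
  have hS := T.isSymmetric_adjoint_comp_self
  refine ⟨hS.eigenvectorBasis hn, fun i => ?_⟩
  set x := hS.eigenvectorBasis hn i
  have h := hS.apply_eigenvectorBasis hn i
  rw [← T.sq_singularValues_fin hn] at h
  have hadj : LinearMap.adjoint T = T := hT.isSymmetric.adjoint_eq
  replace h : T (T x) = (T.singularValues i ^ 2) • x := by
    rw [LinearMap.comp_apply] at h
    change LinearMap.adjoint T (T x) = _ • x at h
    rwa [hadj] at h
  set s := T.singularValues i
  have hs : 0 ≤ s := T.singularValues_nonneg i
  -- From `T² x = s² x`, `(T + s)(T - s) x = 0`; so `y` would be an eigenvector for `-s`, which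
  -- positivity excludes when `s > 0`. When `s = 0`, `‖T x‖² = ⟪x, T² x⟫ = 0`.
  set y := T x - s • x
  have hy : T y = - (s • y) := by
    simp only [y, map_sub, map_smul, h, smul_sub, smul_smul, pow_two]
    abel
  have h1 : 0 ≤ ⟪T y, y⟫ := hT.inner_nonneg_left y
  rcases hs.eq_or_lt with h0 | h0
  · have : T (T x) = 0 := by rw [h, ← h0]; simp
    have h2 : ⟪T x, T x⟫ = 0 := by
      rw [hT.isSymmetric x (T x), this, inner_zero_right]
    rw [inner_self_eq_zero.1 h2, ← h0, zero_smul]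
  · rw [hy, inner_neg_left, real_inner_smul_left, real_inner_self_eq_norm_sq] at h1
    have h3 : y = 0 := by
      have : ‖y‖ ^ 2 ≤ 0 := by nlinarith [sq_nonneg ‖y‖]
      simpa using le_antisymm this (sq_nonneg _)
    exact sub_eq_zero.1 h3

/-- Each singular value equals `‖T x‖` for a unit eigenvector `x` of `T* T`. -/
theorem LinearMap.singularValues_le_of_norm_le {E F : Type*} [NormedAddCommGroup E]
    [InnerProductSpace ℝ E] [FiniteDimensional ℝ E] [NormedAddCommGroup F]
    [InnerProductSpace ℝ F] [FiniteDimensional ℝ F] (T : E →ₗ[ℝ] F) {C : ℝ} (hC : 0 ≤ C)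
    (h : ∀ x, ‖T x‖ ≤ C * ‖x‖) (i : ℕ) : T.singularValues i ≤ C := by
  by_cases hi : i < Module.finrank ℝ E
  · have hS := T.isSymmetric_adjoint_comp_self
    let x := hS.eigenvectorBasis rfl ⟨i, hi⟩
    have hx : ‖x‖ = 1 := (hS.eigenvectorBasis rfl).orthonormal.1 _
    have h1 : T.singularValues i ^ 2 = ‖T x‖ ^ 2 := by
      have h2 := hS.apply_eigenvectorBasis rfl ⟨i, hi⟩
      rw [← T.sq_singularValues_of_lt rfl hi, LinearMap.comp_apply] at h2
      change _ = (_ : ℝ) • x at h2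
      rw [← real_inner_self_eq_norm_sq, ← LinearMap.adjoint_inner_right]
      change _ = ⟪x, LinearMap.adjoint T (T (hS.eigenvectorBasis rfl ⟨i, hi⟩))⟫
      rw [h2, real_inner_smul_right, real_inner_self_eq_norm_sq, hx]
      simp
    have h3 := h x
    rw [hx, mul_one] at h3
    rw [(sq_eq_sq₀ (T.singularValues_nonneg i) (norm_nonneg _)).1 h1]
    exact h3
  · push Not at hi
    simpa [singularValues_of_finrank_le _ hi] using hC

theorem Matrix.rank_add_le_add {m n : Type*} [Fintype m] [Fintype n] (X Y : Matrix m n ℝ) :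
    (X + Y).rank ≤ X.rank + Y.rank := by
  rw [Matrix.rank, Matrix.mulVecLin_add]
  refine le_trans (Submodule.finrank_mono ?_) (Submodule.finrank_add_le_finrank_add_finrank _ _)
  rintro _ ⟨x, rfl⟩
  exact Submodule.add_mem_sup (LinearMap.mem_range_self _ x) (LinearMap.mem_range_self _ x)

/-! ### Frobenius geometry and rank-one decompositions. -/

namespace SymMat

variable {d : ℕ}

theorem norm_sq_eq (U : SymMat d) : ‖U‖ ^ 2 = ∑ i, ∑ j, toMat U i j ^ 2 := by
  rw [← real_inner_self_eq_norm_sq, inner_eq]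
  simp [pow_two]

theorem inner_ident (U : SymMat d) : ⟪U, ident d⟫ = (toMat U).trace := by
  simp [inner_eq, toMat_ident, Matrix.one_apply, Matrix.trace]

/-- Cauchy–Schwarz in each row: the Frobenius norm dominates the operator norm. -/
theorem norm_toEuclideanLin_le (U : SymMat d) (x : EuclideanSpace ℝ (Fin d)) :
    ‖Matrix.toEuclideanLin (toMat U) x‖ ≤ ‖U‖ * ‖x‖ := by
  refine le_of_sq_le_sq ?_ (by positivity)
  rw [mul_pow, norm_sq_eq, EuclideanSpace.norm_sq_eq, EuclideanSpace.norm_sq_eq, Finset.sum_mul]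
  refine Finset.sum_le_sum fun i _ => ?_
  simpa [Matrix.ofLp_toLpLin, Matrix.mulVec, dotProduct] using
    Finset.sum_mul_sq_le_sq_mul_sq Finset.univ (toMat U i) x

/-- The rank-one matrix `x xᵀ`. -/
def outer (x : EuclideanSpace ℝ (Fin d)) : SymMat d :=
  ⟨Matrix.vecMulVec x x, by ext i j; simp [Matrix.vecMulVec_apply, mul_comm]⟩

theorem toMat_outer (x : EuclideanSpace ℝ (Fin d)) : toMat (outer x) = Matrix.vecMulVec x x := rfl

theorem norm_outer (x : EuclideanSpace ℝ (Fin d)) : ‖outer x‖ = ‖x‖ ^ 2 := by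
  refine (sq_eq_sq₀ (norm_nonneg _) (by positivity)).1 ?_
  rw [norm_sq_eq, EuclideanSpace.norm_sq_eq, pow_two, Finset.sum_mul_sum]
  simp [toMat_outer, Matrix.vecMulVec_apply, mul_pow]

theorem trace_outer (x : EuclideanSpace ℝ (Fin d)) : (toMat (outer x)).trace = ‖x‖ ^ 2 := by
  rw [EuclideanSpace.norm_sq_eq]
  simp [toMat_outer, Matrix.vecMulVec_apply, Matrix.trace, pow_two]

theorem toEuclideanLin_outer (x y : EuclideanSpace ℝ (Fin d)) :
    Matrix.toEuclideanLin (toMat (outer x)) y = ⟪x, y⟫ • x := by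
  ext i
  simp [toMat_outer, Matrix.vecMulVec_mulVec, PiLp.inner_apply,
    dotProduct, mul_comm]

theorem outer_mem_psdCone (x : EuclideanSpace ℝ (Fin d)) : outer x ∈ psdCone d := by
  have h := Matrix.posSemidef_vecMulVec_self_star (x : Fin d → ℝ)
  exact h

theorem sum_smul_outer_mem_psdCone {ι : Type*} (s : Finset ι) (a : ι → ℝ) (ha : ∀ i, 0 ≤ a i)
    (x : ι → EuclideanSpace ℝ (Fin d)) : ∑ i ∈ s, a i • outer (x i) ∈ psdCone d := by
  simp only [psdCone, Set.mem_ofPred_eq, map_sum, map_smul]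
  exact Matrix.posSemidef_sum s fun i _ => (outer_mem_psdCone (x i)).smul (ha i)

theorem rank_sum_smul_outer_le {ι : Type*} (s : Finset ι) (a : ι → ℝ)
    (x : ι → EuclideanSpace ℝ (Fin d)) :
    (toMat (∑ i ∈ s, a i • outer (x i))).rank ≤ s.card := by
  classical
  induction s using Finset.induction_on with
  | empty => simp
  | insert i s hi ih =>
    rw [Finset.sum_insert hi, Finset.card_insert_of_notMem hi, map_add, add_comm]
    refine (Matrix.rank_add_le_add _ _).trans (add_le_add ih ?_)
    rw [map_smul, toMat_outer, ← Matrix.smul_vecMulVec]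
    exact Matrix.rank_vecMulVec_le _ _

/-- For a positive operator the singular values serve as eigenvalues, so this spectral decomposition
is indexed exactly as in `kyFan` and can be truncated at `r`. -/
theorem exists_eq_sum_smul_outer {U : SymMat d} (hU : U ∈ psdCone d) :
    ∃ b : OrthonormalBasis (Fin d) ℝ (EuclideanSpace ℝ (Fin d)),
      U = ∑ i : Fin d, (Matrix.toEuclideanLin (toMat U)).singularValues i • outer (b i) := by
  obtain ⟨b, hb⟩ := LinearMap.IsPositive.exists_orthonormalBasis_singularValues
    (Matrix.isPositive_toEuclideanLin_iff.2 hU) (finrank_euclideanSpace_fin (𝕜 := ℝ) (n := d))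
  refine ⟨b, toMat_injective (Matrix.toEuclideanLin.injective (b.toBasis.ext fun i => ?_))⟩
  rw [b.coe_toBasis, hb]
  simp only [map_sum, map_smul, LinearMap.sum_apply, LinearMap.smul_apply, toEuclideanLin_outer]
  rw [Finset.sum_eq_single i]
  · simp
  · intro j _ hj
    simp [b.inner_eq_zero hj]
  · simp

end SymMat

/-! ### The Ky Fan norm and low-rank truncation. -/

theorem kyFan_two_smul {d : ℕ} (r : ℕ) (U : SymMat d) : kyFan r ((2 : ℝ) • U) = 2 * kyFan r U := by
  simp [kyFan, LinearMap.singularValues_smul _ zero_le_two, Finset.mul_sum]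

theorem kyFan_zero {d : ℕ} (r : ℕ) : kyFan r (0 : SymMat d) = 0 := by
  simp [kyFan]

theorem kyFan_le_mul_norm {d : ℕ} (r : ℕ) (U : SymMat d) : kyFan r U ≤ r * ‖U‖ := by
  have h : ∀ i ∈ Finset.range r, (Matrix.toEuclideanLin (SymMat.toMat U)).singularValues i ≤ ‖U‖ :=
    fun i _ => LinearMap.singularValues_le_of_norm_le _ (norm_nonneg U) U.norm_toEuclideanLin_le i
  simpa [kyFan] using Finset.sum_le_sum h

/-- A positive semidefinite matrix is the sum of a positive semidefinite matrix of rank at most `r`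
and a remainder bounded by the difference of its trace and its Ky Fan `r`-norm. -/
theorem exists_rank_le_add_of_mem_psdCone {d : ℕ} {r : ℕ} (hrd : r ≤ d) {U : SymMat d}
    (hU : U ∈ psdCone d) :
    ∃ X ∈ psdCone d, (SymMat.toMat X).rank ≤ r ∧
      ‖U - X‖ ≤ ⟪U, SymMat.ident d⟫ - kyFan r U := by
  obtain ⟨b, hb⟩ := SymMat.exists_eq_sum_smul_outer hU
  set s := (Matrix.toEuclideanLin (SymMat.toMat U)).singularValues with hs
  have hs0 : ∀ i, 0 ≤ s i := LinearMap.singularValues_nonneg _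
  have hb1 : ∀ i, ‖b i‖ = 1 := b.orthonormal.1
  -- `P` carries the `r` terms summed by `kyFan`, and the tail `Q` sums to trace minus Ky Fan norm.
  -- Since `r ≤ d`, `P` matches all of `Finset.range r`.
  let P : Finset (Fin d) := Finset.univ.filter fun i => (i : ℕ) < r
  let Q : Finset (Fin d) := Finset.univ.filter fun i => ¬ (i : ℕ) < r
  have hmap : P.map Fin.valEmbedding = Finset.range r := by
    ext i
    simp only [P, Finset.mem_map, Finset.mem_filter, Finset.mem_univ, true_and, Finset.mem_range,
      Fin.valEmbedding_apply]
    exact ⟨fun ⟨j, hj, e⟩ => e ▸ hj, fun hi => ⟨⟨i, hi.trans_le hrd⟩, hi, rfl⟩⟩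
  refine ⟨∑ i ∈ P, s i • SymMat.outer (b i),
    SymMat.sum_smul_outer_mem_psdCone P _ (fun i => hs0 i) _, ?_, ?_⟩
  · refine (SymMat.rank_sum_smul_outer_le P _ _).trans_eq ?_
    rw [← Finset.card_map Fin.valEmbedding, hmap, Finset.card_range]
  · have hUX : U - ∑ i ∈ P, s i • SymMat.outer (b i) = ∑ i ∈ Q, s i • SymMat.outer (b i) := by
      rw [sub_eq_iff_eq_add', Finset.sum_filter_add_sum_filter_not]
      exact hb
    have htr : ⟪U, SymMat.ident d⟫ = ∑ i : Fin d, s i := by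
      rw [SymMat.inner_ident]
      conv_lhs => rw [hb]
      simp [SymMat.trace_outer, hb1, Matrix.trace_sum]
    have hky : kyFan r U = ∑ i ∈ P, s i := by
      rw [kyFan, ← hmap, Finset.sum_map]
      rfl
    rw [hUX, htr, hky, ← Finset.sum_filter_add_sum_filter_not (Finset.univ : Finset (Fin d)) (fun i => (i : ℕ) < r),
      add_sub_cancel_left]
    refine norm_sum_le_of_le _ fun i _ => ?_
    rw [norm_smul, SymMat.norm_outer, hb1, Real.norm_of_nonneg (hs0 i)]
    simp

/-! ### Subgradients and conjugate of the positively homogeneous `f2`. -/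

section Subgradient

variable {d : ℕ} {r : ℕ} {c : ℝ}

theorem f2_zero : f2 r c (0 : SymMat d) = 0 := by simp [f2, kyFan_zero]

/-- A subgradient of the positively homogeneous function `f₂` is dominated by `f₂`. -/
theorem inner_le_f2_of_mem_convexSubdiff {W U : SymMat d} (h : W ∈ convexSubdiff (f2 r c) U) :
    ⟪W, U⟫ = f2 r c U ∧ ∀ Y, ⟪W, Y⟫ ≤ f2 r c Y := by
  -- The test points `0` and `2U` give the two inequalities in `⟪W, U⟫ = f2 U`.
  have h0 := h 0
  have h2 := h ((2 : ℝ) • U)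
  have hU : ⟪W, U⟫ = f2 r c U := by
    have e : f2 r c ((2 : ℝ) • U) = 2 * f2 r c U := by
      simp only [f2, kyFan_two_smul]; ring
    rw [e, two_smul, add_sub_cancel_right] at h2
    rw [f2_zero, zero_sub, inner_neg_right] at h0
    linarith
  refine ⟨hU, fun Y => ?_⟩
  have hY := h Y
  rw [inner_sub_right] at hY
  linarith

/-- Test the domination at `Y = W` and divide by `‖W‖`. -/
theorem norm_le_of_inner_le_f2 (hc : 0 ≤ c) {W : SymMat d} (h : ∀ Y, ⟪W, Y⟫ ≤ f2 r c Y) :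
    ‖W‖ ≤ c * r := by
  have h1 := (h W).trans (mul_le_mul_of_nonneg_left (kyFan_le_mul_norm r W) hc)
  rw [real_inner_self_eq_norm_sq] at h1
  rcases (norm_nonneg W).eq_or_lt with h0 | h0
  · rw [← h0]; positivity
  · refine le_of_mul_le_mul_right ?_ h0
    linarith

/-- All terms of the supremum are nonpositive, and `U = 0` attains zero. -/
theorem f2conj_eq_zero {W : SymMat d} (h : ∀ Y, ⟪W, Y⟫ ≤ f2 r c Y) : f2conj r c W = 0 := by
  refine le_antisymm (iSup₂_le fun Y _ => ?_) ?_
  · exact_mod_cast sub_nonpos.2 (h Y)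
  · have h0 : (0 : SymMat d) ∈ psdCone d := by
      simp only [psdCone, Set.mem_ofPred_eq, map_zero]
      exact Matrix.PosSemidef.zero
    refine le_trans ?_ (le_iSup₂ (0 : SymMat d) h0)
    simp [f2_zero]

end Subgradient

/-- Symmetry is built into the space, so the cone is an intersection of closed half-spaces, one for
each vector `x`. -/
theorem isClosed_psdCone (d : ℕ) : IsClosed (psdCone d) := by
  have h : psdCone d =
      ⋂ x : Fin d → ℝ, {U : SymMat d | 0 ≤ x ⬝ᵥ (SymMat.toMat U).mulVec x} := by
    ext U
    have hH : (SymMat.toMat U).IsSymm := U.2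
    simp [psdCone, Matrix.posSemidef_iff_dotProduct_mulVec, hH]
  rw [h]
  refine isClosed_iInter fun x => isClosed_le continuous_const ?_
  let L : SymMat d →ₗ[ℝ] ℝ :=
    { toFun := fun U => x ⬝ᵥ (SymMat.toMat U).mulVec x
      map_add' := fun U V => by simp [Matrix.add_mulVec, dotProduct_add]
      map_smul' := fun t U => by simp [Matrix.smul_mulVec, dotProduct_smul] }
  exact L.continuous_of_finiteDimensional

/-! ### The objective, its level sets, and the auxiliary function. -/

section Objective

variable {d p : ℕ} {n r : ℕ} {A : SymMat d →ₗ[ℝ] EuclideanSpace ℝ (Fin p)}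
  {b : EuclideanSpace ℝ (Fin p)} {c α : ℝ}

theorem continuous_f1 : Continuous (f1 n A b c) := by
  have hA : Continuous A := A.continuous_of_finiteDimensional
  unfold f1
  fun_prop

theorem Jc_eq (U : SymMat d) :
    Jc n A b r c U =
      1 / (n : ℝ) * ‖A U - b‖ ^ 2 + c * (⟪U, SymMat.ident d⟫ - kyFan r U) := by
  simp only [Jc, f1, f2]; ring

theorem Jc_nonneg (hrd : r ≤ d) (hc : 0 ≤ c) {U : SymMat d} (hU : U ∈ psdCone d) :
    0 ≤ Jc n A b r c U := by
  obtain ⟨X, -, -, hX⟩ := exists_rank_le_add_of_mem_psdCone hrd hU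
  have h : 0 ≤ ⟪U, SymMat.ident d⟫ - kyFan r U := (norm_nonneg _).trans hX
  rw [Jc_eq]
  positivity

/-- Under the restricted isometry property, the penalized objective has bounded level sets. -/
theorem SatisfiesRIP.exists_norm_le_of_Jc_le (hA : SatisfiesRIP A r) (hrd : r ≤ d) (hn : 0 < n)
    (hc : 0 < c) (M : ℝ) :
    ∃ K, ∀ U ∈ psdCone d, Jc n A b r c U ≤ M → ‖U‖ ≤ K := by
  obtain ⟨R, ⟨hR, -⟩, -, hR1⟩ := hA
  set A' : SymMat d →L[ℝ] EuclideanSpace ℝ (Fin p) := LinearMap.toContinuousLinearMap A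
  -- `M / c` bounds the remainder `U - X`; the rest bounds `X` through `(1 - R)‖X‖² ≤ ‖A X‖²`. The
  -- extra `1`s come from `t ≤ t² + 1`, which avoids square roots.
  refine ⟨M / c + ((n * M + 1 + ‖b‖ + ‖A'‖ * (M / c)) ^ 2 / (1 - R) + 1), fun U hU hJ => ?_⟩
  obtain ⟨X, hX, hXr, hUX⟩ := exists_rank_le_add_of_mem_psdCone hrd hU
  have ht : 0 ≤ ⟪U, SymMat.ident d⟫ - kyFan r U := (norm_nonneg _).trans hUX
  have hn' : (0 : ℝ) < n := by exact_mod_cast hn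
  rw [Jc_eq] at hJ
  have h1 : ‖U - X‖ ≤ M / c := by
    refine hUX.trans ((le_div_iff₀ hc).2 ?_)
    have : 0 ≤ 1 / (n : ℝ) * ‖A U - b‖ ^ 2 := by positivity
    linarith
  have h2 : ‖A U - b‖ ≤ n * M + 1 := by
    have h3 : 1 / (n : ℝ) * ‖A U - b‖ ^ 2 ≤ M := by
      have := mul_nonneg hc.le ht
      linarith
    rw [one_div, inv_mul_le_iff₀ hn'] at h3
    nlinarith [sq_nonneg (‖A U - b‖ - 1), norm_nonneg (A U - b)]
  have h3 : ‖A X‖ ≤ n * M + 1 + ‖b‖ + ‖A'‖ * (M / c) := by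
    have e : A X = (A U - b) + b - A' (U - X) := by
      simp only [A', LinearMap.coe_toContinuousLinearMap', map_sub]; abel
    rw [e]
    refine (norm_sub_le _ _).trans (add_le_add ((norm_add_le _ _).trans ?_) ?_)
    · linarith
    · exact (A'.le_opNorm _).trans (mul_le_mul_of_nonneg_left h1 (norm_nonneg _))
  have h4 : ‖X‖ ≤ (n * M + 1 + ‖b‖ + ‖A'‖ * (M / c)) ^ 2 / (1 - R) + 1 := by
    have h5 := ((hR X hX hXr).1).trans (pow_le_pow_left₀ (norm_nonneg _) h3 2)
    have h6 : ‖X‖ ^ 2 ≤ (n * M + 1 + ‖b‖ + ‖A'‖ * (M / c)) ^ 2 / (1 - R) := by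
      rw [le_div_iff₀ (by linarith)]
      linarith
    nlinarith [sq_nonneg (‖X‖ - 1), norm_nonneg X]
  calc ‖U‖ = ‖(U - X) + X‖ := by rw [sub_add_cancel]
    _ ≤ _ := (norm_add_le _ _).trans (add_le_add h1 h4)

variable (n A b c α) in
/-- The finite part `f₁(U) - ⟪U, W⟫ + (α/2) ‖U - V‖² - ⟪T, U - V⟫` of the auxiliary function. -/
def auxReal (z : Quad d) : ℝ :=
  f1 n A b c (z 0) - ⟪z 0, z 1⟫ + α / 2 * ‖z 0 - z 2‖ ^ 2 - ⟪z 3, z 0 - z 2⟫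

theorem auxE_eq_coe {z : Quad d} (h0 : z 0 ∈ psdCone d) (h1 : ∀ Y, ⟪z 1, Y⟫ ≤ f2 r c Y) :
    auxE n A b r c α z = (auxReal n A b c α z : EReal) := by
  rw [auxE, if_pos h0, f2conj_eq_zero h1, add_zero]
  rfl

theorem continuous_auxReal : Continuous (auxReal n A b c α) := by
  have := continuous_f1 (n := n) (A := A) (b := b) (c := c)
  unfold auxReal
  fun_prop

/-- Keeping a single competitor in the supremum gives a lower bound valid even where the conjugate
is infinite; this is what the subgradient inequality at arbitrary nearby points requires. -/
theorem coe_le_auxE {z : Quad d} (h0 : z 0 ∈ psdCone d) {U : SymMat d} (hU : U ∈ psdCone d) :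
    ((auxReal n A b c α z + (⟪z 1, U⟫ - f2 r c U) : ℝ) : EReal) ≤ auxE n A b r c α z := by
  rw [auxE, if_pos h0, EReal.coe_add]
  exact add_le_add le_rfl (le_iSup₂ (f := fun U (_ : U ∈ psdCone d) =>
    ((⟪z 1, U⟫ - f2 r c U : ℝ) : EReal)) U hU)

end Objective

/-! ### Subgradient calculus and accumulation points. -/

/-- Second-order expansion of the smooth coupling terms of the auxiliary function. -/
theorem coupling_expansion {H : Type*} [NormedAddCommGroup H] [InnerProductSpace ℝ H] (α : ℝ)
    (U W V T p w q t : H) :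
    (⟪p, w⟫ - ⟪U, W⟫ + ⟪W - w, q⟫ + α / 2 * (‖U - V‖ ^ 2 - ‖p - q‖ ^ 2) - ⟪T, U - V⟫
        + ⟪t, p - q⟫) + (⟪U - p, w⟫ - α / 2 * (‖U - q‖ ^ 2 - ‖p - q‖ ^ 2) + ⟪t, U - p⟫) =
      (⟪q - p, W - w⟫ + ⟪t - α • (p - q), V - q⟫ + ⟪q - p, T - t⟫)
        - ⟪W - w, U - p⟫ - α * ⟪U - p, V - q⟫ + α / 2 * ‖V - q‖ ^ 2 - ⟪T - t, U - p⟫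
        + ⟪T - t, V - q⟫ := by
  simp only [← real_inner_self_eq_norm_sq, inner_sub_left, inner_sub_right, real_inner_smul_left]
  simp only [real_inner_comm]
  ring

/-- A quadratic lower expansion yields a regular subgradient. -/
theorem mem_regularSubdiff_of_quadratic {H : Type*} [NormedAddCommGroup H] [InnerProductSpace ℝ H]
    {f : H → EReal} {x v : H} {C a : ℝ} (hx : f x = a)
    (h : ∀ y, ((a + ⟪v, y - x⟫ - C * ‖y - x‖ ^ 2 : ℝ) : EReal) ≤ f y) :
    v ∈ regularSubdiff f x := by
  refine ⟨by simp [hx], by simp [hx], fun ε hε => ?_⟩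
  -- Within radius `ε / (|C| + 1)`, the quadratic error is at most `ε ‖y - x‖`.
  have hC : 0 < |C| + 1 := by positivity
  filter_upwards [Metric.ball_mem_nhds x (div_pos hε hC)] with y hy
  rw [mem_ball_iff_norm, lt_div_iff₀ hC] at hy
  refine le_trans ?_ (h y)
  rw [hx]
  norm_cast
  nlinarith [norm_nonneg (y - x), le_abs_self C, sq_nonneg ‖y - x‖,
    mul_le_mul_of_nonneg_right (le_abs_self C) (sq_nonneg ‖y - x‖),
    mul_le_mul_of_nonneg_left hy.le (norm_nonneg (y - x))]

theorem regularSubdiff_subset_limitingSubdiff {H : Type*} [NormedAddCommGroup H]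
    [InnerProductSpace ℝ H] (f : H → EReal) (x : H) : regularSubdiff f x ⊆ limitingSubdiff f x :=
  fun v hv => ⟨hv.1, hv.2.1, fun _ => x, fun _ => v, tendsto_const_nhds, tendsto_const_nhds,
    fun _ => hv, tendsto_const_nhds⟩

theorem norm_quad_le {d : ℕ} (U W V T : SymMat d) :
    ‖quad U W V T‖ ≤ ‖U‖ + ‖W‖ + ‖V‖ + ‖T‖ := by
  refine le_of_sq_le_sq ?_ (by positivity)
  rw [PiLp.norm_sq_eq_of_L2, Fin.sum_univ_four]
  change ‖U‖ ^ 2 + ‖W‖ ^ 2 + ‖V‖ ^ 2 + ‖T‖ ^ 2 ≤ _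
  have hU := norm_nonneg U
  have hW := norm_nonneg W
  have hV := norm_nonneg V
  have hT := norm_nonneg T
  nlinarith [mul_nonneg hU hW, mul_nonneg hU hV, mul_nonneg hU hT, mul_nonneg hW hV,
    mul_nonneg hW hT, mul_nonneg hV hT]

theorem isClosed_accPts {X : Type*} [TopologicalSpace X] (x : ℕ → X) : IsClosed (accPts x) :=
  isClosed_setOfPred_clusterPt

theorem isCompact_accPts {X : Type*} [PseudoMetricSpace X] [ProperSpace X] {x : ℕ → X} {o : X}
    {K : ℝ} (h : ∀ l, x l ∈ Metric.closedBall o K) :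
    (accPts x).Nonempty ∧ IsCompact (accPts x) := by
  have hc := isCompact_closedBall o K
  refine ⟨?_, hc.of_isClosed_subset (isClosed_accPts x) fun y hy =>
    Metric.isClosed_closedBall.mem_of_mapClusterPt hy (Eventually.of_forall h)⟩
  obtain ⟨y, -, hy⟩ := hc.exists_mapClusterPt (u := x) (f := atTop)
    (tendsto_principal.2 (Eventually.of_forall h))
  exact ⟨y, hy⟩

/-! ### Estimates for serious steps. -/

section Steps

variable {d p : ℕ} {n r : ℕ} {A : SymMat d →ₗ[ℝ] EuclideanSpace ℝ (Fin p)}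
  {b : EuclideanSpace ℝ (Fin p)} {c α κ : ℝ}

theorem auxReal_quad (U W V T : SymMat d) :
    auxReal n A b c α (quad U W V T) =
      f1 n A b c U - ⟪U, W⟫ + α / 2 * ‖U - V‖ ^ 2 - ⟪T, U - V⟫ := rfl

/-- Domination replaces `⟪W, U⟫` by `f2 U`. By Cauchy–Schwarz the inexactness term consumes at most
the fraction `1 - κ` of the proximal term, leaving `κα/2`. -/
theorem Jc_add_le_auxReal {U W V T : SymMat d} (hW : ∀ Y, ⟪W, Y⟫ ≤ f2 r c Y)
    (hT : ‖T‖ ≤ (1 - κ) * α / 2 * ‖U - V‖) :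
    Jc n A b r c U + κ * α / 2 * ‖U - V‖ ^ 2 ≤ auxReal n A b c α (quad U W V T) := by
  have h1 := hW U
  have h2 : ⟪T, U - V⟫ ≤ (1 - κ) * α / 2 * ‖U - V‖ * ‖U - V‖ :=
    (real_inner_le_norm _ _).trans (mul_le_mul_of_nonneg_right hT (norm_nonneg _))
  rw [real_inner_comm] at h1
  rw [auxReal_quad, Jc]
  nlinarith

/-- The proximal center `V` is itself a competitor in the subproblem, and there `⟪W, V⟫ = f2 V`. -/
theorem auxReal_le_Jc {U W V T : SymMat d} (hV : V ∈ psdCone d) (hW : ⟪W, V⟫ = f2 r c V)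
    (hmin : IsMinOn (subObj n A b c α W V T) (psdCone d) U) :
    auxReal n A b c α (quad U W V T) ≤ Jc n A b r c V := by
  have h : subObj n A b c α W V T U ≤ subObj n A b c α W V T V := hmin hV
  rw [real_inner_comm] at hW
  simp only [subObj, sub_self, norm_zero] at h
  rw [auxReal_quad, Jc, inner_sub_right]
  linarith

/-- The first component is zero by optimality of `U`; the second uses that `V` attains the supremum
defining the conjugate at `W`; the other two are partial gradients of the coupling terms. -/
theorem mem_regularSubdiff_auxE {U W V T : SymMat d} (hα : 0 ≤ α) (hU : U ∈ psdCone d)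
    (hV : V ∈ psdCone d) (hW : ⟪W, V⟫ = f2 r c V) (hW' : ∀ Y, ⟪W, Y⟫ ≤ f2 r c Y)
    (hmin : IsMinOn (subObj n A b c α W V T) (psdCone d) U) :
    quad 0 (V - U) (T - α • (U - V)) (V - U) ∈
      regularSubdiff (auxE n A b r c α) (quad U W V T) := by
  -- In `coupling_expansion`, three mixed products contribute `1` each and the product weighted by
  -- `α` contributes `α`; the remaining square is nonnegative.
  refine mem_regularSubdiff_of_quadratic (C := 3 + α) (auxE_eq_coe (z := quad U W V T) hU hW')
    fun y => ?_
  by_cases hy : y 0 ∈ psdCone d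
  swap
  · rw [auxE, if_neg hy]; exact le_top
  -- Choosing `V` as competitor makes the conjugate's lower bound affine in the second variable.
  refine le_trans ?_ (coe_le_auxE hy hV)
  rw [EReal.coe_le_coe_iff]
  have hm : subObj n A b c α W V T U ≤ subObj n A b c α W V T (y 0) := hmin hy
  have hinner : ⟪quad 0 (V - U) (T - α • (U - V)) (V - U), y - quad U W V T⟫ =
      ⟪V - U, y 1 - W⟫ + ⟪T - α • (U - V), y 2 - V⟫ + ⟪V - U, y 3 - T⟫ := by
    rw [PiLp.inner_apply, Fin.sum_univ_four]
    change ⟪(0 : SymMat d), y 0 - U⟫ + ⟪V - U, y 1 - W⟫ + ⟪T - α • (U - V), y 2 - V⟫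
      + ⟪V - U, y 3 - T⟫ = _
    rw [inner_zero_left, zero_add]
  have hexp := coupling_expansion α (y 0) (y 1) (y 2) (y 3) U W V T
  have n0 : ‖y 0 - U‖ ≤ ‖y - quad U W V T‖ := PiLp.norm_apply_le (y - quad U W V T) 0
  have n1 : ‖y 1 - W‖ ≤ ‖y - quad U W V T‖ := PiLp.norm_apply_le (y - quad U W V T) 1
  have n2 : ‖y 2 - V‖ ≤ ‖y - quad U W V T‖ := PiLp.norm_apply_le (y - quad U W V T) 2
  have n3 : ‖y 3 - T‖ ≤ ‖y - quad U W V T‖ := PiLp.norm_apply_le (y - quad U W V T) 3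
  rw [hinner, auxReal_quad]
  generalize ‖y - quad U W V T‖ = s at *
  have hs : 0 ≤ s := (norm_nonneg _).trans n0
  have bound : ∀ {x z : SymMat d}, ‖x‖ ≤ s → ‖z‖ ≤ s → |⟪x, z⟫| ≤ s ^ 2 := fun hx hz => by
    rw [pow_two]
    exact (abs_real_inner_le_norm _ _).trans (mul_le_mul hx hz (norm_nonneg _) hs)
  have r1 := (abs_le.1 (bound n1 n0)).2
  have r2 := mul_le_mul_of_nonneg_left (abs_le.1 (bound n0 n2)).2 hα
  have r3 := (abs_le.1 (bound n3 n0)).2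
  have r4 := (abs_le.1 (bound n3 n2)).1
  have r5 : 0 ≤ α / 2 * ‖y 2 - V‖ ^ 2 := by positivity
  simp only [subObj] at hm
  simp only [auxReal]
  rw [inner_sub_left (y 1) W V, inner_sub_left (y 0) U W, inner_sub_right T (y 0) U] at hexp
  rw [← hW]
  linarith

/-- The sequences of stability centers, subgradients and inexactness terms at serious steps. -/
structure IsSeriousSeq (n : ℕ) (A : SymMat d →ₗ[ℝ] EuclideanSpace ℝ (Fin p))
    (b : EuclideanSpace ℝ (Fin p)) (r : ℕ) (c α κ : ℝ) (u w e : ℕ → SymMat d) : Prop where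
  mem : ∀ l, u l ∈ psdCone d
  subgrad : ∀ l, w l ∈ convexSubdiff (f2 r c) (u l)
  min : ∀ l, IsMinOn (subObj n A b c α (w l) (u l) (e (l + 1))) (psdCone d) (u (l + 1))
  inexact : ∀ l, ‖e (l + 1)‖ ≤ (1 - κ) * α / 2 * ‖u (l + 1) - u l‖

namespace IsSeriousSeq

variable {u w e : ℕ → SymMat d} (h : IsSeriousSeq n A b r c α κ u w e)
include h

theorem inner_eq (l : ℕ) : ⟪w l, u l⟫ = f2 r c (u l) :=
  (inner_le_f2_of_mem_convexSubdiff (h.subgrad l)).1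

theorem inner_le (l : ℕ) : ∀ Y, ⟪w l, Y⟫ ≤ f2 r c Y :=
  (inner_le_f2_of_mem_convexSubdiff (h.subgrad l)).2

theorem auxE_eq (l : ℕ) : auxE n A b r c α (quad (u (l + 1)) (w l) (u l) (e (l + 1))) =
    (auxReal n A b c α (quad (u (l + 1)) (w l) (u l) (e (l + 1))) : EReal) :=
  auxE_eq_coe (z := quad (u (l + 1)) (w l) (u l) (e (l + 1))) (h.mem (l + 1)) (h.inner_le l)

theorem descent (l : ℕ) :
    Jc n A b r c (u (l + 1)) + κ * α / 2 * ‖u (l + 1) - u l‖ ^ 2 ≤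
      auxReal n A b c α (quad (u (l + 1)) (w l) (u l) (e (l + 1))) :=
  Jc_add_le_auxReal (h.inner_le l) (h.inexact l)

theorem auxReal_le (l : ℕ) :
    auxReal n A b c α (quad (u (l + 1)) (w l) (u l) (e (l + 1))) ≤ Jc n A b r c (u l) :=
  auxReal_le_Jc (h.mem l) (h.inner_eq l) (h.min l)

/-- The sandwich makes `J` nonincreasing along the centers, which therefore stay in one bounded
level set. Domination bounds the subgradients, and the serious-step test bounds the inexactness
terms. -/
theorem exists_norm_quad_le (hn : 0 < n) (hrd : r ≤ d) (hA : SatisfiesRIP A r) (hc : 0 < c)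
    (hα : 0 < α) (hκ0 : 0 < κ) :
    ∃ K, ∀ l, ‖quad (u (l + 1)) (w l) (u l) (e (l + 1))‖ ≤ K := by
  have hJ : ∀ l, Jc n A b r c (u l) ≤ Jc n A b r c (u 0) := fun l => by
    induction l with
    | zero => exact le_rfl
    | succ l ih =>
      have h1 := h.descent l
      have h2 := h.auxReal_le l
      have h3 : 0 ≤ κ * α / 2 * ‖u (l + 1) - u l‖ ^ 2 := by positivity
      linarith
  obtain ⟨K, hK⟩ := hA.exists_norm_le_of_Jc_le (b := b) hrd hn hc (Jc n A b r c (u 0))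
  have hu : ∀ l, ‖u l‖ ≤ K := fun l => hK _ (h.mem l) (hJ l)
  refine ⟨K + c * r + K + α / 2 * (K + K), fun l => (norm_quad_le _ _ _ _).trans ?_⟩
  have h1 := norm_le_of_inner_le_f2 hc.le (h.inner_le l)
  have h2 := h.inexact l
  have h3 : (1 - κ) * α / 2 * ‖u (l + 1) - u l‖ ≤ α / 2 * (K + K) := by
    refine mul_le_mul (by nlinarith) ((norm_sub_le _ _).trans (add_le_add (hu _) (hu _)))
      (norm_nonneg _) (by positivity)
  have := hu l
  have := hu (l + 1)
  linarith

theorem exists_tendsto (hrd : r ≤ d) (hc : 0 < c) (hα : 0 < α) (hκ0 : 0 < κ) :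
    ∃ Υ : ℝ, Tendsto (fun l => auxReal n A b c α (quad (u (l + 1)) (w l) (u l) (e (l + 1))))
      atTop (𝓝 Υ) := by
  refine ⟨_, tendsto_atTop_ciInf (antitone_nat_of_succ_le fun l => ?_) ⟨0, ?_⟩⟩
  · have h1 := h.descent l
    have h2 := h.auxReal_le (l + 1)
    have h3 : 0 ≤ κ * α / 2 * ‖u (l + 1) - u l‖ ^ 2 := by positivity
    linarith
  · rintro _ ⟨l, rfl⟩
    have h1 := h.descent l
    have h2 := Jc_nonneg (n := n) (A := A) (b := b) hrd hc.le (h.mem (l + 1))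
    have h3 : 0 ≤ κ * α / 2 * ‖u (l + 1) - u l‖ ^ 2 := by positivity
    dsimp only
    linarith

/-- The conjugate need not be continuous, but domination by `f2` is a closed condition, so the
conjugate vanishes at the limit as well and only `auxReal` has to be passed to the limit. -/
theorem auxE_eq_of_mem_accPts {Υ : ℝ}
    (hΥ : Tendsto (fun l => auxReal n A b c α (quad (u (l + 1)) (w l) (u l) (e (l + 1))))
      atTop (𝓝 Υ)) {z : Quad d}
    (hz : z ∈ accPts fun l => quad (u (l + 1)) (w l) (u l) (e (l + 1))) :
    auxE n A b r c α z = (Υ : EReal) := by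
  obtain ⟨φ, hφ, hlim⟩ := MapClusterPt.tendsto_subseq hz
  have hcoord : ∀ i : Fin 4, Continuous fun z : Quad d => z i := fun i => by fun_prop
  have h0 : z 0 ∈ psdCone d := (isClosed_psdCone d).mem_of_tendsto
    (((hcoord 0).tendsto z).comp hlim) (Eventually.of_forall fun m => h.mem (φ m + 1))
  have h1 : ∀ Y, ⟪z 1, Y⟫ ≤ f2 r c Y := fun Y =>
    le_of_tendsto ((((hcoord 1).tendsto z).comp hlim).inner (𝕜 := ℝ) tendsto_const_nhds)
      (Eventually.of_forall fun m => h.inner_le (φ m) Y)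
  rw [auxE_eq_coe h0 h1, tendsto_nhds_unique ((continuous_auxReal.tendsto z).comp hlim)
    (hΥ.comp hφ.tendsto_atTop)]

theorem infEDist_limitingSubdiff_le (hα : 0 < α) (hκ0 : 0 < κ) (l : ℕ) :
    Metric.infEDist 0 (limitingSubdiff (auxE n A b r c α)
        (quad (u (l + 1)) (w l) (u l) (e (l + 1)))) ≤
      ENNReal.ofReal ((2 + 2 * α) * ‖u (l + 1) - u l‖) := by
  refine (Metric.infEDist_le_edist_of_mem (regularSubdiff_subset_limitingSubdiff _ _
    (mem_regularSubdiff_auxE hα.le (h.mem (l + 1)) (h.mem l) (h.inner_eq l) (h.inner_le l)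
      (h.min l)))).trans ?_
  rw [edist_dist, dist_zero_left]
  refine ENNReal.ofReal_le_ofReal ((norm_quad_le _ _ _ _).trans ?_)
  have h1 := norm_sub_le (e (l + 1)) (α • (u (l + 1) - u l))
  have h2 := h.inexact l
  rw [norm_smul, Real.norm_of_nonneg hα.le] at h1
  rw [norm_zero, norm_sub_rev (u l)]
  -- Two components contribute `2`, the proximal gradient `α`, and the inexactness term at most
  -- `α/2`, within `2 + 2α`.
  nlinarith [mul_nonneg (mul_nonneg hκ0.le hα.le) (norm_nonneg (u (l + 1) - u l)),
    mul_nonneg hα.le (norm_nonneg (u (l + 1) - u l))]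

end IsSeriousSeq

end Steps

/-! ### From the full run to the subsequence of serious steps. -/

section Run

variable {d p : ℕ} {n r : ℕ} {A : SymMat d →ₗ[ℝ] EuclideanSpace ℝ (Fin p)}
  {b : EuclideanSpace ℝ (Fin p)} {c α κ tol : ℝ} {eps : ℕ → ℝ} {U V W Δ : ℕ → SymMat d}

theorem seriousIdx_le_nth (hinf : {k | IsSerious α κ U V Δ k}.Infinite) :
    ∀ l, seriousIdx α κ U V Δ l ≤ Nat.nth (IsSerious α κ U V Δ) l
  | 0 => Nat.zero_le _
  | l + 1 => Nat.nth_strictMono hinf (Nat.lt_succ_self l)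

/-- A serious `j` would be the `m`-th serious iteration with `m < l`, but `seriousIdx` at `l ≥ 1`
already exceeds the `(l - 1)`-th, because a center's index is one more than that of the iteration
producing it. -/
theorem not_isSerious_of_seriousIdx_le {l j : ℕ} (hinf : {k | IsSerious α κ U V Δ k}.Infinite)
    (h1 : seriousIdx α κ U V Δ l ≤ j) (h2 : j < Nat.nth (IsSerious α κ U V Δ) l) :
    ¬ IsSerious α κ U V Δ j := by
  intro hj
  obtain ⟨m, -, rfl⟩ := Nat.exists_lt_card_nth_eq hj
  have hml : m < l := (Nat.nth_strictMono hinf).lt_iff_lt.1 h2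
  obtain ⟨l, rfl⟩ : ∃ k, l = k + 1 := ⟨l - 1, by omega⟩
  exact absurd ((Nat.nth_strictMono hinf).lt_iff_lt.1 (Nat.lt_of_succ_le h1)) (by omega)

/-- The stability center and its subgradient do not change between consecutive serious steps. -/
theorem IsRun.eq_seriousIdx (hrun : IsRun n A b r c α κ tol eps U V W Δ)
    (hinf : {k | IsSerious α κ U V Δ k}.Infinite) (l : ℕ) :
    U (Nat.nth (IsSerious α κ U V Δ) l) = U (seriousIdx α κ U V Δ l) ∧
      W (Nat.nth (IsSerious α κ U V Δ) l) = W (seriousIdx α κ U V Δ l) := by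
  have key : ∀ j, seriousIdx α κ U V Δ l ≤ j → j ≤ Nat.nth (IsSerious α κ U V Δ) l →
      U j = U (seriousIdx α κ U V Δ l) ∧ W j = W (seriousIdx α κ U V Δ l) := by
    intro j hj
    induction j, hj using Nat.le_induction with
    | base => exact fun _ => ⟨rfl, rfl⟩
    | succ j hj ih =>
      intro h
      have hns := not_isSerious_of_seriousIdx_le hinf hj h
      rw [hrun.null_center j hns, hrun.null_subgrad j hns]
      exact ih (Nat.le_of_succ_le h)
  exact key _ (seriousIdx_le_nth hinf l) le_rfl

theorem IsRun.isSeriousSeq (hrun : IsRun n A b r c α κ tol eps U V W Δ)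
    (hinf : {k | IsSerious α κ U V Δ k}.Infinite) :
    IsSeriousSeq n A b r c α κ (fun l => U (seriousIdx α κ U V Δ l))
      (fun l => W (seriousIdx α κ U V Δ l)) (fun l => Δ (seriousIdx α κ U V Δ l)) := by
  have hser : ∀ l, IsSerious α κ U V Δ (Nat.nth (IsSerious α κ U V Δ) l) :=
    Nat.nth_mem_of_infinite hinf
  refine ⟨fun l => ?_, fun l => ?_, fun l => ?_, fun l => ?_⟩
  · cases l with
    | zero => exact hrun.init_mem
    | succ l =>
      simp only [seriousIdx, hrun.serious_center _ (hser l)]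
      exact hrun.trial_mem _
  · cases l with
    | zero => exact hrun.init_subgrad
    | succ l => exact hrun.serious_subgrad _ (hser l)
  · have h := hrun.trial_min (Nat.nth (IsSerious α κ U V Δ) l)
    rw [← hrun.serious_center _ (hser l), (hrun.eq_seriousIdx hinf l).1,
      (hrun.eq_seriousIdx hinf l).2] at h
    exact h
  · have h := (hser l).le
    rw [← hrun.serious_center _ (hser l), (hrun.eq_seriousIdx hinf l).1] at h
    exact h

end Run

end

theorem proposition6 {d p : ℕ} (n r : ℕ) (hn : 0 < n) (hr : 1 ≤ r) (hrd : r ≤ d)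
    (A : SymMat d →ₗ[ℝ] EuclideanSpace ℝ (Fin p)) (b : EuclideanSpace ℝ (Fin p))
    (hA : SatisfiesRIP A r)
    (c α κ : ℝ) (hc : 0 < c) (hα : 0 < α) (hκ0 : 0 < κ) (hκ1 : κ < 1)
    (eps : ℕ → ℝ) (U V W Δ : ℕ → SymMat d)
    (hrun : IsRun n A b r c α κ 0 eps U V W Δ)
    (hinf : {k | IsSerious α κ U V Δ k}.Infinite) :
    -- `E` is finite along the sequence
    (∀ l, auxE n A b r c α (seriousQuad α κ U V W Δ l) ≠ ⊤ ∧
      auxE n A b r c α (seriousQuad α κ U V W Δ l) ≠ ⊥) ∧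
    -- (1)
    (∀ l, (Jc n A b r c (U (seriousIdx α κ U V Δ (l + 1))) : EReal) ≤
      auxE n A b r c α (seriousQuad α κ U V W Δ l)) ∧
    -- (2)
    (∀ l, auxE n A b r c α (seriousQuad α κ U V W Δ (l + 1)) ≤
      auxE n A b r c α (seriousQuad α κ U V W Δ l) -
        ((κ * α / 2 *
          ‖U (seriousIdx α κ U V Δ (l + 1)) - U (seriousIdx α κ U V Δ l)‖ ^ 2 : ℝ) : EReal)) ∧
    -- (3)
    ((accPts (seriousQuad α κ U V W Δ)).Nonempty ∧
      IsCompact (accPts (seriousQuad α κ U V W Δ))) ∧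
    -- (4)
    (∃ Υ : ℝ,
      Tendsto (fun l => auxE n A b r c α (seriousQuad α κ U V W Δ l)) atTop (𝓝 (Υ : EReal)) ∧
      ∀ z ∈ accPts (seriousQuad α κ U V W Δ), auxE n A b r c α z = (Υ : EReal)) ∧
    -- (5)
    (∃ ρ : ℝ, 0 < ρ ∧ ∀ l,
      Metric.infEDist 0 (limitingSubdiff (auxE n A b r c α) (seriousQuad α κ U V W Δ l)) ≤
        ENNReal.ofReal (ρ *
          ‖U (seriousIdx α κ U V Δ (l + 1)) - U (seriousIdx α κ U V Δ l)‖)) := by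
  have h := hrun.isSeriousSeq hinf
  refine ⟨fun l => ?_, fun l => ?_, fun l => ?_, ?_, ?_, 2 + 2 * α, by positivity,
    h.infEDist_limitingSubdiff_le hα hκ0⟩
  · rw [seriousQuad, h.auxE_eq l]
    exact ⟨EReal.coe_ne_top _, EReal.coe_ne_bot _⟩
  · rw [seriousQuad, h.auxE_eq l, EReal.coe_le_coe_iff]
    refine le_trans ?_ (h.descent l)
    exact le_add_of_nonneg_right (by positivity)
  · rw [seriousQuad, h.auxE_eq (l + 1), seriousQuad, h.auxE_eq l, ← EReal.coe_sub,
      EReal.coe_le_coe_iff]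
    -- The upper half of the sandwich at `l + 1` meets its lower half at `l` in `J(u (l+1))`.
    exact le_sub_iff_add_le.2 ((add_le_add_left (h.auxReal_le (l + 1)) _).trans (h.descent l))
  · obtain ⟨K, hK⟩ := h.exists_norm_quad_le hn hrd hA hc hα hκ0
    have : ProperSpace (Quad d) := FiniteDimensional.proper_real (Quad d)
    exact isCompact_accPts (o := 0) fun l => mem_closedBall_zero_iff.2 (hK l)
  · obtain ⟨Υ, hΥ⟩ := h.exists_tendsto hrd hc hα hκ0
    refine ⟨Υ, ?_, fun z hz => h.auxE_eq_of_mem_accPts hΥ hz⟩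
    simp only [seriousQuad, h.auxE_eq]
    exact (continuous_coe_real_ereal.tendsto Υ).comp hΥ
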